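/- Let $\{1,\dots,n\}$ be partitioned into two sets $K_1,K_2$, let $w_{K_1},w_{K_2}>0$, and put $w_i=w_{K_1}$ for $i\in K_1$ and $w_i=w_{K_2}$ for $i\in K_2$. Let $\mathcal P_{\mathbf w}=\{y\in\mathbb R^n : \sum_{i=1}^n w_i|y_i|\le 1\}$ be the weighted cross-polytope. A face $\mathcal F$ of $\mathcal P_{\mathbf w}$ is said to be supported on $K\subseteq\{1,\dots,n\}$ if $\mathcal F=\mathrm{conv}\{j_i e_i/w_i : i\in K\}$ for some signs $j_i\in\{-1,1\}$. For faces $\mathcal F\subsetneq\mathcal G$, the internal angle $\beta(\mathcal F,\mathcal G)$ is the fraction of the unit sphere covered by the cone generated by $\mathcal G-x$, where $x$ is any point of the relative interior of $\mathcal F$ and the sphere is the unit sphere of the linear span of this cone; moreover $\beta(\mathcal F,\mathcal F)=1$, and $\beta(\mathcal F,\mathcal G)=0$ if $\mathcal F\not\subseteq\mathcal G$. Let $k_1,k_2,t_1,t_2\ge 0$ be integers with $k_1+k_2\ge1$, and let $\mathcal F\subseteq\mathcal G$ be nonempty faces of $\mathcal P_{\mathbf w}$ supported on $K$ and $L$ respectively,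 with $|K\cap K_1|=k_1$, $|K\cap K_2|=k_2$, $|L\cap K_1|=k_1+t_1$, $|L\cap K_2|=k_2+t_2$. Write $\beta(k_1,k_2|t_1,t_2)=\beta(\mathcal F,\mathcal G)$. Let $$Z=(k_1w_{K_1}^2+k_2w_{K_2}^2)X_1-w_{K_1}^2\sum_{i=1}^{t_1}X_i'-w_{K_2}^2\sum_{i=1}^{t_2}X_i'',$$ where $X_1\sim N\bigl(0,\tfrac{1}{2(k_1w_{K_1}^2+k_2w_{K_2}^2)}\bigr)$, $X_i'\sim HN\bigl(0,\tfrac1{2w_{K_1}^2}\bigr)$ for $1\le i\le t_1$ and $X_i''\sim HN\bigl(0,\tfrac1{2w_{K_2}^2}\bigr)$ for $1\le i\le t_2$ are all independent; here $HN(0,\sigma^2)$ is the law of $|X|$ for $X\sim N(0,\sigma^2)$. Then $Z$ has a continuous probability density, and for every probability density $p_Z$ of $Z$ that is continuous at $0$, $$\beta(k_1,k_2|t_1,t_2)=c_0\,p_Z(0),\qquad c_0=\frac{\sqrt\pi}{2^{t_1+t_2}}\bigl((k_1+t_1)w_{K_1}^2+(k_2+t_2)w_{K_2}^2\bigr)^{1/2}.$$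 In particular, the internal angle depends only on $k_1,k_2,t_1,t_2$ (and the weights). -/

import Mathlib

open MeasureTheory ProbabilityTheory

noncomputable section

/-- The half normal distribution `HN(0, v)`: the law of `|X|` for `X ∼ N(0, v)`. -/
def halfNormal (v : NNReal) : Measure ℝ :=
  (gaussianReal 0 v).map (fun x => |x|)

/-- `p` is a probability density function of the real random variable `Z` under `P`. -/
def IsDensityOf {Ω : Type*} [MeasurableSpace Ω] (p : ℝ → ℝ) (Z : Ω → ℝ) (P : Measure Ω) : Prop :=
  Measurable p ∧ (∀ x, 0 ≤ p x) ∧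
    P.map Z = volume.withDensity (fun x => ENNReal.ofReal (p x))

/-- The weighted `ℓ₁`-ball (weighted cross-polytope) `{y : ∑ wᵢ |yᵢ| ≤ 1}` in `ℝⁿ`. -/
def weightedBall {n : ℕ} (w : Fin n → ℝ) : Set (EuclideanSpace ℝ (Fin n)) :=
  {y | ∑ i, w i * |y i| ≤ 1}

/-- `F` is a face of the weighted `ℓ₁`-ball that is supported on the index set `K`: a nonempty
face which is the convex hull of the vertices `± eᵢ / wᵢ`, `i ∈ K`, with one sign for each `i`. -/
def IsFaceSupportedOn {n : ℕ} (w : Fin n → ℝ) (F : Set (EuclideanSpace ℝ (Fin n)))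
    (K : Finset (Fin n)) : Prop :=
  F.Nonempty ∧ IsExposed ℝ (weightedBall w) F ∧
    ∃ j : Fin n → ℝ, (∀ i, j i = 1 ∨ j i = -1) ∧
      F = convexHull ℝ
        ((fun i => EuclideanSpace.single i (j i / w i)) '' (K : Set (Fin n)))

/-- The cone obtained by observing `G` from (the relative interior of) `F`, with apex moved to the
origin. For convex `F ⊆ G` the conic hull of `G - x` is the same for every `x` in the relative
interior of `F`, so the union over `x` is each one of them. -/
def observedCone {E : Type*} [NormedAddCommGroup E] [InnerProductSpace ℝ E] (F G : Set E) :
    Set E :=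
  {v | ∃ x ∈ intrinsicInterior ℝ F, ∃ y ∈ G, ∃ c : ℝ, 0 ≤ c ∧ v = c • (y - x)}

/-- The fraction of the unit sphere of the Euclidean space `V` (with respect to its surface
measure) which is covered by the set `C`. -/
def sphereFraction {V : Type*} [NormedAddCommGroup V] [InnerProductSpace ℝ V]
    [FiniteDimensional ℝ V] [MeasurableSpace V] [BorelSpace V] (C : Set V) : ℝ :=
  ((volume : Measure V).toSphere {u | (u : V) ∈ C} /
    (volume : Measure V).toSphere Set.univ).toReal

open Classical in
/-- The internal angle `β(F, G)`: the fraction of the unit sphere covered by the cone obtained by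
observing `G` from `F`, the sphere being taken in the linear span of that cone; it is `0` if `F` is
not contained in `G` and `1` if `F = G`. -/
def internalAngle {n : ℕ} (F G : Set (EuclideanSpace ℝ (Fin n))) : ℝ :=
  if F = G then 1
  else if F ⊆ G then
    sphereFraction
      (V := Submodule.span ℝ (observedCone F G)) {v | (v : EuclideanSpace ℝ (Fin n)) ∈ observedCone F G}
  else 0

end

/-! A cone's share of the unit sphere is its standard Gaussian measure
(`sphereFraction_eq_stdGaussian`), so the angle is a Gaussian probability in the span `V` of the
cone. With `K` nonempty, `V` consists of the vectors supported on `L` and orthogonal to `a =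
faceNormal w j L`, and the cone is cut out of `V` by `0 ≤ j i * v i` for `i ∈ L \ K`.

Let `x` be a standard Gaussian vector in the whole space, conditioned on these `t₁ + t₂` signs, an
event of probability `2 ^ (-(t₁ + t₂))`. The factor `-1/√2` in `a` is chosen so that `⟪a, x⟫` then
has the law of `Z`: indices in `K` add up to the Gaussian term, those in `L \ K` give the negative
half normal terms (`map_eq_stdGaussian_restrict_map`).

Without conditioning, `⟪a, x⟫` is Gaussian and independent of the projection of `x` to `V`. Hence
the density of `Z` at `z` is `2 ^ (t₁ + t₂)` times a Gaussian density times the probability that the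
projection lies in the cone with its walls displaced proportionally to `z`
(`stdGaussian_restrict_map_inner`). This is continuous in `z`, and at `z = 0` the last factor is the
angle. Since `‖a‖ ^ 2` is half the total squared weight `W` of `L`, the Gaussian density at `0` is
`1 / √(π W)`, which gives `c₀`. -/

/-! ### Solid angles as Gaussian measures. -/

section GaussianSphere

variable {V : Type*} [NormedAddCommGroup V] [InnerProductSpace ℝ V] [FiniteDimensional ℝ V]
  [MeasurableSpace V] [BorelSpace V]

/-- The standard Gaussian measure has a radial density. -/
lemma stdGaussian_eq_withDensity :
    stdGaussian V = (volume : Measure V).withDensity (fun x => ENNReal.ofReal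
      ((2 * Real.pi) ^ (Module.finrank ℝ V / 2 : ℝ))⁻¹ *
        ENNReal.ofReal (Real.exp (-(1 / 2) * ‖x‖ ^ 2))) := by
  set c : ℝ := (2 * Real.pi) ^ (Module.finrank ℝ V / 2 : ℝ) with hc
  have hc0 : 0 < c := by positivity
  have hexp : Integrable (fun x : V => Real.exp (-(1 / 2) * ‖x‖ ^ 2)) := by
    have := (GaussianFourier.integrable_cexp_neg_mul_sq_norm_add (V := V) (b := 1 / 2)
      (by norm_num) 0 0).norm
    refine this.congr (.of_forall fun x => ?_)
    simp only [Complex.norm_exp]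
    congr 1
    simp [← Complex.ofReal_pow]
  set f : V → ℝ := fun x => c⁻¹ * Real.exp (-(1 / 2) * ‖x‖ ^ 2) with hf
  have hf0 : ∀ x, 0 ≤ f x := fun x => by positivity
  have hfi : Integrable f := hexp.const_mul _
  have hfun : (fun x : V => ENNReal.ofReal c⁻¹ *
      ENNReal.ofReal (Real.exp (-(1 / 2) * ‖x‖ ^ 2))) = fun x => ENNReal.ofReal (f x) := by
    funext x
    rw [hf, ENNReal.ofReal_mul (by positivity)]
  rw [hfun]
  have : IsFiniteMeasure ((volume : Measure V).withDensity fun x => ENNReal.ofReal (f x)) :=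
    isFiniteMeasure_withDensity_ofReal hfi.2
  -- Comparing characteristic functions reduces the claim to the Fourier integral of the Gaussian.
  apply Measure.ext_of_charFun
  ext t
  rw [charFun_stdGaussian, charFun_apply, integral_withDensity_eq_integral_toReal_smul
    (by fun_prop) (.of_forall fun x => ENNReal.ofReal_lt_top)]
  have key := GaussianFourier.integral_cexp_neg_mul_sq_norm_add (V := V) (b := 1 / 2)
      (by norm_num) Complex.I t
  have hpt : ∀ x : V, (ENNReal.ofReal (f x)).toReal • Complex.exp (inner ℝ x t * Complex.I) =
      (c⁻¹ : ℂ) * Complex.exp (-(1 / 2) * ‖x‖ ^ 2 + Complex.I * inner ℝ t x) := by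
    intro x
    rw [ENNReal.toReal_ofReal (hf0 x), hf, Complex.real_smul, Complex.exp_add, real_inner_comm]
    push_cast
    rw [mul_comm Complex.I]
    ring
  simp_rw [hpt]
  rw [integral_const_mul, key, hc]
  have : (Real.pi / (1 / 2 : ℂ)) ^ (Module.finrank ℝ V / 2 : ℂ) = (c : ℂ) := by
    rw [hc, Complex.ofReal_cpow (by positivity)]
    push_cast
    congr 1
    ring
  rw [this, ← mul_assoc, ← hc, inv_mul_cancel₀ (by exact_mod_cast hc0.ne'), one_mul]
  congr 1
  rw [Complex.I_sq]
  ring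

/-- Polar coordinates for the measure of a cone with respect to a measure with radial density. -/
lemma withDensity_norm_apply_cone [Nontrivial V] (μ : Measure V) [μ.IsAddHaarMeasure]
    {g : ℝ → ENNReal} (hg : Measurable g) {D : Set V} (hD : MeasurableSet D)
    (hDc : ∀ c : ℝ, 0 < c → ∀ v ∈ D, c • v ∈ D) :
    μ.withDensity (fun x => g ‖x‖) D = μ.toSphere {u | (u : V) ∈ D} *
      ∫⁻ r : Set.Ioi (0 : ℝ), g r ∂(Measure.volumeIoiPow (Module.finrank ℝ V - 1)) := by
  have hD' : MeasurableSet {u : Metric.sphere (0 : V) 1 | (u : V) ∈ D} :=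
    measurable_subtype_coe hD
  have h1 : ∀ x : ({0}ᶜ : Set V), D.indicator (fun x => g ‖x‖) (x : V) =
      (fun p : Metric.sphere (0 : V) 1 × Set.Ioi (0 : ℝ) =>
        {u : Metric.sphere (0 : V) 1 | (u : V) ∈ D}.indicator 1 p.1 * g p.2)
        (homeomorphUnitSphereProd V x) := by
    rintro ⟨x, hx⟩
    have hx0 : 0 < ‖x‖ := norm_pos_iff.2 hx
    have hiff : ‖x‖⁻¹ • x ∈ D ↔ x ∈ D := by
      refine ⟨fun h => ?_, hDc _ (inv_pos.2 hx0) _⟩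
      have := hDc _ hx0 _ h
      rwa [smul_smul, mul_inv_cancel₀ hx0.ne', one_smul] at this
    by_cases h : x ∈ D
    · simp [Set.indicator, h, hiff]
    · simp [Set.indicator, h, hiff]
  -- Polar coordinates miss the origin, which is a null set because `V` is nontrivial.
  have h2 : ∫⁻ x, D.indicator (fun x => g ‖x‖) x ∂μ =
      ∫⁻ x : ({0}ᶜ : Set V), D.indicator (fun x => g ‖x‖) (x : V) ∂(μ.comap (↑)) := by
    rw [lintegral_subtype_comap (measurableSet_singleton _).compl, restrict_compl_singleton]
  have h3 := μ.measurePreserving_homeomorphUnitSphereProd.lintegral_comp_emb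
    (Homeomorph.measurableEmbedding _)
    fun p => {u : Metric.sphere (0 : V) 1 | (u : V) ∈ D}.indicator 1 p.1 * g p.2
  rw [withDensity_apply _ hD, ← lintegral_indicator hD, h2, lintegral_congr h1]
  refine h3.trans ((lintegral_prod_mul
    (f := {u : Metric.sphere (0 : V) 1 | (u : V) ∈ D}.indicator 1)
    (g := fun r : Set.Ioi (0 : ℝ) => g r) (measurable_const.indicator hD').aemeasurable
    (hg.comp measurable_subtype_coe).aemeasurable).trans ?_)
  rw [lintegral_indicator_one hD']

/-- The fraction of the unit sphere covered by a cone is its standard Gaussian measure. -/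
lemma sphereFraction_eq_stdGaussian [Nontrivial V] {C : Set V} (hC : MeasurableSet C)
    (hcone : ∀ c : ℝ, 0 < c → ∀ v ∈ C, c • v ∈ C) :
    sphereFraction C = (stdGaussian V).real C := by
  obtain ⟨g, hg, hG⟩ : ∃ g : ℝ → ENNReal, Measurable g ∧
      stdGaussian V = (volume : Measure V).withDensity (fun x => g ‖x‖) :=
    ⟨fun r => ENNReal.ofReal ((2 * Real.pi) ^ (Module.finrank ℝ V / 2 : ℝ))⁻¹ *
      ENNReal.ofReal (Real.exp (-(1 / 2) * r ^ 2)), by fun_prop, stdGaussian_eq_withDensity⟩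
  -- Taking the whole space as cone shows that the radial integral is the inverse of the sphere's
  -- area, so neither has to be computed.
  have huniv : 1 = (volume : Measure V).toSphere Set.univ *
      ∫⁻ r : Set.Ioi (0 : ℝ), g r ∂(Measure.volumeIoiPow (Module.finrank ℝ V - 1)) := by
    rw [← measure_univ (μ := stdGaussian V), hG]
    exact withDensity_norm_apply_cone _ hg .univ fun _ _ _ _ => Set.mem_univ _
  have hcone' := withDensity_norm_apply_cone (volume : Measure V) hg hC hcone
  rw [ENNReal.eq_inv_of_mul_eq_one_left ((mul_comm _ _).trans huniv.symm), ← hG] at hcone'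
  rw [sphereFraction, Measure.real, div_eq_mul_inv]
  exact congrArg ENNReal.toReal hcone'.symm

end GaussianSphere

/-! ### Disintegration of a Gaussian vector along one direction. -/

section GaussianDisintegration

variable {E : Type*} [NormedAddCommGroup E] [InnerProductSpace ℝ E] [FiniteDimensional ℝ E]
  [MeasurableSpace E] [BorelSpace E]

/-- The orthogonal projection of a standard Gaussian vector to a subspace is a standard Gaussian
vector, and it is independent of the component along any vector orthogonal to the subspace. -/
lemma stdGaussian_map_orthogonalProjection_prod_inner (V : Submodule ℝ E) {a : E} (ha : a ∈ Vᗮ) :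
    (stdGaussian E).map (fun x => (V.orthogonalProjectionOnto x, inner ℝ a x)) =
      (stdGaussian V).prod (gaussianReal 0 (‖a‖ ^ 2).toNNReal) := by
  have hmeas : Measurable fun x : E => (V.orthogonalProjectionOnto x, inner ℝ a x) := by fun_prop
  have : IsProbabilityMeasure ((stdGaussian E).map
      (fun x => (V.orthogonalProjectionOnto x, inner ℝ a x))) :=
    Measure.isProbabilityMeasure_map hmeas.aemeasurable
  refine charFun_eq_prod_iff.1 fun t => ?_
  rw [Measure.map_map (by fun_prop) hmeas, charFun_apply, integral_map (by fun_prop)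
    (by fun_prop)]
  set t₁ : V := (WithLp.ofLp t).1
  set t₂ : ℝ := (WithLp.ofLp t).2
  have h1 : ∀ x : E, inner ℝ ((WithLp.toLp 2 ∘ fun x => (V.orthogonalProjectionOnto x, inner ℝ a x)) x) t
      = inner ℝ x ((t₁ : E) + t₂ • a) := by
    intro x
    rw [WithLp.prod_inner_apply, inner_add_right, inner_smul_right, real_inner_comm a x]
    congr 1
    exact V.inner_orthogonalProjectionOnto_eq_of_mem_right t₁ x
  simp_rw [h1]
  rw [← charFun_apply, charFun_stdGaussian, charFun_stdGaussian, charFun_gaussianReal,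
    ← Complex.exp_add]
  have h2 : ‖(t₁ : E) + t₂ • a‖ ^ 2 = ‖t₁‖ ^ 2 + t₂ ^ 2 * ‖a‖ ^ 2 := by
    have h0 : inner ℝ (t₁ : E) a = 0 := ha t₁ t₁.2
    rw [norm_add_sq_real, inner_smul_right, h0, norm_smul, mul_pow]
    simp
  congr 1
  have h3 : ((‖(t₁ : E) + t₂ • a‖ : ℂ)) ^ 2 = (‖t₁‖ : ℂ) ^ 2 + t₂ ^ 2 * (‖a‖ : ℂ) ^ 2 := by
    exact_mod_cast h2
  have h4 : (((‖a‖ ^ 2).toNNReal : ℝ) : ℂ) = (‖a‖ : ℂ) ^ 2 := by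
    rw [Real.coe_toNNReal _ (by positivity)]
    push_cast
    rfl
  rw [h3, h4]
  push_cast
  ring

lemma stdGaussian_map_inner (a : E) :
    (stdGaussian E).map (fun x => inner ℝ a x) = gaussianReal 0 (‖a‖ ^ 2).toNNReal := by
  have h := stdGaussian_map_orthogonalProjection_prod_inner (⊥ : Submodule ℝ E) (a := a) (by simp)
  have h2 := congrArg (Measure.map Prod.snd) h
  rw [Measure.map_map measurable_snd (by fun_prop), Measure.map_snd_prod] at h2
  simpa [Function.comp_def] using h2

lemma stdGaussian_hyperplane_eq_zero {b : E} (hb : b ≠ 0) (r : ℝ) :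
    stdGaussian E {x | inner ℝ b x = r} = 0 := by
  have h : stdGaussian E {x | inner ℝ b x = r} =
      (stdGaussian E).map (fun x => inner ℝ b x) {r} := by
    rw [Measure.map_apply (by fun_prop) (measurableSet_singleton _)]
    rfl
  have : NullSingletonClass (gaussianReal 0 (‖b‖ ^ 2).toNNReal) :=
    nullSingletonClass_gaussianReal (by simpa using hb)
  rw [h, stdGaussian_map_inner, measure_singleton]

/-- The standard Gaussian measure of an intersection of half-spaces with moving, non-degenerate
boundaries depends continuously on the displacement. -/
lemma continuous_stdGaussian_real_halfSpaces {ι : Type*} (T : Finset ι) (b : ι → E) (c : ι → ℝ)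
    (hb : ∀ i ∈ T, b i ≠ 0) :
    Continuous fun z : ℝ => (stdGaussian E).real {x | ∀ i ∈ T, 0 ≤ inner ℝ (b i) x + c i * z} := by
  have hmeas : ∀ z : ℝ, MeasurableSet {x : E | ∀ i ∈ T, 0 ≤ inner ℝ (b i) x + c i * z} := by
    intro z
    have : {x : E | ∀ i ∈ T, 0 ≤ inner ℝ (b i) x + c i * z} =
        ⋂ i ∈ T, {x : E | 0 ≤ inner ℝ (b i) x + c i * z} := by
      ext; simp
    rw [this]
    exact T.measurableSet_biInter fun i _ => measurableSet_le (by fun_prop) (by fun_prop)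
  simp_rw [← fun z => integral_indicator_one (μ := stdGaussian E) (hmeas z)]
  refine continuous_iff_continuousAt.2 fun z₀ => ?_
  refine continuousAt_of_dominated (bound := fun _ => 1)
    (.of_forall fun z => ((measurable_one.indicator (hmeas z))).aestronglyMeasurable)
    (.of_forall fun z => .of_forall fun x => ?_) (integrable_const _) ?_
  · refine (norm_indicator_le_norm_self _ _).trans ?_
    simp
  -- Off finitely many null hyperplanes no constraint is tight at `z₀`, so the indicator is locally
  -- constant in `z` there and dominated convergence applies.
  · have hae : ∀ᵐ x ∂stdGaussian E, ∀ i ∈ T, inner ℝ (b i) x ≠ -(c i * z₀) := by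
      refine (Finset.eventually_all T).2 fun i hi => ?_
      exact measure_eq_zero_iff_ae_notMem.1 (stdGaussian_hyperplane_eq_zero (hb i hi) _)
    filter_upwards [hae] with x hx
    have hev : ∀ᶠ z in nhds z₀, ∀ i ∈ T,
        (0 ≤ inner ℝ (b i) x + c i * z ↔ 0 ≤ inner ℝ (b i) x + c i * z₀) := by
      refine (Finset.eventually_all T).2 fun i hi => ?_
      have hcont : Continuous fun z : ℝ => inner ℝ (b i) x + c i * z := by fun_prop
      have hne : inner ℝ (b i) x + c i * z₀ ≠ 0 := fun h => hx i hi (by linarith)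
      rcases hne.lt_or_gt with h | h
      · filter_upwards [hcont.continuousAt.eventually (gt_mem_nhds h)] with z hz
        exact ⟨fun h' => absurd hz h'.not_gt, fun h' => absurd h h'.not_gt⟩
      · filter_upwards [hcont.continuousAt.eventually (lt_mem_nhds h)] with z hz
        exact ⟨fun _ => h.le, fun _ => hz.le⟩
    refine ContinuousAt.congr (f := fun _ => ({x : E | ∀ i ∈ T,
      0 ≤ inner ℝ (b i) x + c i * z₀}).indicator (1 : E → ℝ) x) continuousAt_const ?_
    filter_upwards [hev] with z hz
    have : (x ∈ {x : E | ∀ i ∈ T, 0 ≤ inner ℝ (b i) x + c i * z}) ↔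
        x ∈ {x : E | ∀ i ∈ T, 0 ≤ inner ℝ (b i) x + c i * z₀} := by
      simp only [Set.mem_ofPred_eq]
      exact forall₂_congr hz
    by_cases h : x ∈ {x : E | ∀ i ∈ T, 0 ≤ inner ℝ (b i) x + c i * z₀}
    · rw [Set.indicator_of_mem h, Set.indicator_of_mem (this.2 h)]
    · rw [Set.indicator_of_notMem h, Set.indicator_of_notMem (mt this.1 h)]

/-- Disintegration of a standard Gaussian vector `x`, restricted to a polyhedral cone, along
`⟪a, x⟫`: if the normal vectors of the cone lie in `V + ℝ a`, with `a` orthogonal to `V`, then the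
law of `⟪a, x⟫` has the stated density. -/
lemma stdGaussian_restrict_map_inner {ι : Type*} (T : Finset ι) (V : Submodule ℝ E) {a : E}
    (ha : a ∈ Vᗮ) (ha0 : a ≠ 0) (b : ι → V) (c : ι → ℝ) :
    ((stdGaussian E).restrict {x | ∀ i ∈ T, 0 ≤ inner ℝ ((b i : E) + c i • a) x}).map
      (fun x => inner ℝ a x) =
    volume.withDensity fun z => ENNReal.ofReal (gaussianPDFReal 0 (‖a‖ ^ 2).toNNReal z *
      (stdGaussian V).real {x | ∀ i ∈ T, 0 ≤ inner ℝ (b i) x + c i * z}) := by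
  have hv : (‖a‖ ^ 2).toNNReal ≠ 0 := by simpa using ha0
  set S : Set (V × ℝ) := {p | ∀ i ∈ T, 0 ≤ inner ℝ (b i) p.1 + c i * p.2} with hS
  have hSm : MeasurableSet S := by
    have : S = ⋂ i ∈ T, {p : V × ℝ | 0 ≤ inner ℝ (b i) p.1 + c i * p.2} := by
      ext; simp [hS]
    rw [this]
    exact T.measurableSet_biInter fun i _ => measurableSet_le (by fun_prop) (by fun_prop)
  -- The constraints see `x` only through its projection to `V` and `⟪a, x⟫`, which are independent.
  have hpre : {x : E | ∀ i ∈ T, 0 ≤ inner ℝ ((b i : E) + c i • a) x} =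
      (fun x => (V.orthogonalProjectionOnto x, inner ℝ a x)) ⁻¹' S := by
    ext x
    simp only [hS, Set.mem_ofPred_eq, Set.mem_preimage]
    refine forall₂_congr fun i _ => ?_
    rw [inner_add_left, inner_smul_left]
    have : inner ℝ (b i) (V.orthogonalProjectionOnto x) = inner ℝ (b i : E) x :=
      V.inner_orthogonalProjectionOnto_eq_of_mem_left (b i) x
    rw [this]
    rfl
  have hm : Measurable fun x : E => (V.orthogonalProjectionOnto x, inner ℝ a x) := by fun_prop
  ext A hA
  rw [Measure.map_apply (by fun_prop) hA, Measure.restrict_apply (by measurability), hpre,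
    withDensity_apply _ hA]
  have h1 : (fun x : E => inner ℝ a x) ⁻¹' A ∩
      (fun x => (V.orthogonalProjectionOnto x, inner ℝ a x)) ⁻¹' S =
      (fun x => (V.orthogonalProjectionOnto x, inner ℝ a x)) ⁻¹' ((Prod.snd ⁻¹' A) ∩ S) := rfl
  have hAS : MeasurableSet ((Prod.snd ⁻¹' A : Set (V × ℝ)) ∩ S) := (measurable_snd hA).inter hSm
  rw [h1, ← Measure.map_apply hm hAS, stdGaussian_map_orthogonalProjection_prod_inner V ha,
    Measure.prod_apply_symm hAS, gaussianReal_of_var_ne_zero _ hv,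
    lintegral_withDensity_eq_lintegral_mul _ (measurable_gaussianPDF _ _)
      (measurable_measure_prodMk_right hAS), ← lintegral_indicator hA]
  refine lintegral_congr fun z => ?_
  by_cases hz : z ∈ A
  · rw [Set.indicator_of_mem hz, Pi.mul_apply, ENNReal.ofReal_mul (gaussianPDFReal_nonneg _ _ _),
      ofReal_measureReal]
    congr 2
    ext x
    simp [hz, hS]
  · rw [Set.indicator_of_notMem hz, Pi.mul_apply]
    have : (fun x : V => (x, z)) ⁻¹' ((Prod.snd ⁻¹' A) ∩ S) = ∅ := by
      ext x
      simp [hz]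
    rw [this]
    simp

end GaussianDisintegration

/-- Two densities of the same law which are continuous at a point agree there. -/
lemma eq_of_isDensityOf_of_continuousAt {Ω : Type*} [MeasurableSpace Ω] {P : Measure Ω}
    [IsFiniteMeasure P] {Z : Ω → ℝ} {p q : ℝ → ℝ} (hp : IsDensityOf p Z P) (hq : IsDensityOf q Z P)
    {x : ℝ} (hpx : ContinuousAt p x) (hqx : ContinuousAt q x) : p x = q x := by
  obtain ⟨hpm, hp0, hpe⟩ := hp
  obtain ⟨hqm, hq0, hqe⟩ := hq
  have hfin : ∫⁻ y, ENNReal.ofReal (p y) ≠ ⊤ := by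
    rw [← setLIntegral_univ, ← withDensity_apply _ .univ, ← hpe]
    exact measure_ne_top _ _
  have hae := (withDensity_eq_iff hpm.ennreal_ofReal.aemeasurable
    hqm.ennreal_ofReal.aemeasurable hfin).1 (hpe.symm.trans hqe)
  by_contra hne
  have hev : ∀ᶠ y in nhds x, p y ≠ q y := (hpx.sub hqx).eventually_ne (sub_ne_zero.2 hne) |>.mono
    fun y => sub_ne_zero.1
  -- A set of full Lebesgue measure is dense, so it meets the neighbourhood on which `p` and `q`
  -- differ.
  have hd : Dense {y | ENNReal.ofReal (p y) = ENNReal.ofReal (q y)} :=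
    Measure.dense_of_ae (μ := (volume : Measure ℝ)) hae
  obtain ⟨y, hy, hy'⟩ := (hd.inter_nhds_nonempty hev)
  exact hy' ((ENNReal.ofReal_eq_ofReal_iff (hp0 y) (hq0 y)).1 hy)

/-! ### Half normal laws. -/

section HalfNormal

instance isProbabilityMeasure_halfNormal (v : NNReal) : IsProbabilityMeasure (halfNormal v) :=
  Measure.isProbabilityMeasure_map (by fun_prop)

lemma halfNormal_map_const_mul {c : ℝ} (hc : 0 ≤ c) (v : NNReal) :
    (halfNormal v).map (fun x => c * x) = halfNormal ((c ^ 2).toNNReal * v) := by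
  have h := gaussianReal_map_const_mul (μ := 0) (v := v) c
  rw [mul_zero] at h
  have hcc : (c ^ 2).toNNReal = .mk (c ^ 2) (sq_nonneg _) :=
    Real.toNNReal_of_nonneg (sq_nonneg _)
  rw [halfNormal, halfNormal, hcc, ← h, Measure.map_map (by fun_prop) (by fun_prop),
    Measure.map_map (by fun_prop) (by fun_prop)]
  congr 1
  ext x
  simp [abs_mul, abs_of_nonneg hc]

/-- By symmetry, `j * |X|` is `X` conditioned on a half-line of probability one half, hence the
factor 2. Nonzero variance is needed because an atom at `0` would be counted twice. -/
lemma halfNormal_map_sign_mul {j : ℝ} (hj : j = 1 ∨ j = -1) {v : NNReal} (hv : v ≠ 0) :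
    (halfNormal v).map (fun x => j * x) =
      (2 : ENNReal) • (gaussianReal 0 v).restrict {x | 0 ≤ j * x} := by
  have hatom : gaussianReal 0 v {0} = 0 :=
    (nullSingletonClass_gaussianReal hv).measure_singleton 0
  ext A hA
  have hD : MeasurableSet {x : ℝ | 0 ≤ j * x} := measurableSet_le (by fun_prop) (by fun_prop)
  have hA' : MeasurableSet (A ∩ {x : ℝ | 0 ≤ j * x}) := hA.inter hD
  rw [halfNormal, Measure.map_map (by fun_prop) (by fun_prop),
    Measure.map_apply (by fun_prop) hA, Measure.smul_apply, Measure.restrict_apply hA, smul_eq_mul,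
    two_mul]
  have hneg : gaussianReal 0 v ((fun x => -x) ⁻¹' (A ∩ {x : ℝ | 0 ≤ j * x})) =
      gaussianReal 0 v (A ∩ {x : ℝ | 0 ≤ j * x}) := by
    rw [← Measure.map_apply (by fun_prop) hA', gaussianReal_map_neg, neg_zero]
  have hset : ((fun x => j * x) ∘ fun x : ℝ => |x|) ⁻¹' A =
      (A ∩ {x : ℝ | 0 ≤ j * x}) ∪ (fun x => -x) ⁻¹' (A ∩ {x : ℝ | 0 ≤ j * x}) := by
    ext x
    simp only [Set.mem_preimage, Function.comp_apply, Set.mem_union, Set.mem_inter_iff,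
      Set.mem_ofPred_eq]
    rcases hj with rfl | rfl <;> rcases le_total 0 x with h | h
    · rcases h.eq_or_lt with rfl | h'
      · simp
      · simp [abs_of_nonneg h, h, h'.not_ge]
    · rcases h.eq_or_lt with rfl | h'
      · simp
      · simp [abs_of_nonpos h, h, h'.not_ge]
    · rcases h.eq_or_lt with rfl | h'
      · simp
      · simp [abs_of_nonneg h, h, h'.not_ge]
    · rcases h.eq_or_lt with rfl | h'
      · simp
      · simp [abs_of_nonpos h, h, h'.not_ge]
  rw [hset]
  refine (measure_union₀ (hA'.preimage measurable_neg).nullMeasurableSet ?_).trans (by rw [hneg])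
  refine measure_mono_null (fun x hx => ?_) hatom
  obtain ⟨⟨-, h1⟩, -, h2⟩ := hx
  simp only [Set.mem_ofPred_eq] at h1 h2
  rcases hj with rfl | rfl <;> simp only [Set.mem_singleton_iff] <;> linarith

end HalfNormal

/-! ### Gaussian vectors conditioned on signs. -/

section SignedGaussian

variable {ι : Type*} [Fintype ι] [DecidableEq ι]

/-- The law of a standard Gaussian vector conditioned on the signs of the coordinates in `T`. -/
noncomputable def signedGaussian (T : Finset ι) (j : ι → ℝ) : ι → Measure ℝ :=
  fun i => if i ∈ T then (halfNormal 1).map (fun x => j i * x) else gaussianReal 0 1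

instance (T : Finset ι) (j : ι → ℝ) (i : ι) : IsProbabilityMeasure (signedGaussian T j i) := by
  unfold signedGaussian
  split_ifs
  · exact Measure.isProbabilityMeasure_map (by fun_prop)
  · infer_instance

lemma pi_signedGaussian (T : Finset ι) {j : ι → ℝ} (hj : ∀ i, j i = 1 ∨ j i = -1) :
    Measure.pi (signedGaussian T j) = (2 : ENNReal) ^ T.card •
      (Measure.pi fun _ : ι => gaussianReal 0 1).restrict {x | ∀ i ∈ T, 0 ≤ j i * x i} := by
  set B : ι → Set ℝ := fun i => if i ∈ T then {x | 0 ≤ j i * x} else Set.univ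
  have hB : ∀ i, MeasurableSet (B i) := by
    intro i
    by_cases h : i ∈ T
    · simp only [B, h, if_true]
      exact measurableSet_le (by fun_prop) (by fun_prop)
    · simp [B, h]
  have hD : {x : ι → ℝ | ∀ i ∈ T, 0 ≤ j i * x i} = Set.pi Set.univ B := by
    ext x
    simp only [Set.mem_ofPred_eq, Set.mem_pi, Set.mem_univ, true_imp_iff, B]
    refine forall_congr' fun i => ?_
    by_cases h : i ∈ T <;> simp [h]
  rw [hD]
  refine Measure.pi_eq fun s hs => ?_
  rw [Measure.smul_apply, Measure.restrict_apply (.univ_pi hs), ← Set.pi_inter_distrib,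
    Measure.pi_pi, smul_eq_mul]
  have : ∀ i, signedGaussian T j i (s i) =
      (if i ∈ T then 2 else 1) * gaussianReal 0 1 (s i ∩ B i) := by
    intro i
    by_cases h : i ∈ T
    · simp only [signedGaussian, h, if_true, B]
      rw [halfNormal_map_sign_mul (hj i) one_ne_zero, Measure.smul_apply,
        Measure.restrict_apply (hs i), smul_eq_mul]
    · simp [signedGaussian, h, B]
  simp_rw [this]
  rw [Finset.prod_mul_distrib, Finset.prod_ite_mem, Finset.univ_inter, Finset.prod_const]

lemma charFun_pi_signedGaussian (T : Finset ι) (j a : ι → ℝ) (t : ℝ) :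
    charFun ((Measure.pi (signedGaussian T j)).map fun x => ∑ i, a i * x i) t =
      ∏ i, if i ∈ T then charFun (halfNormal 1) (j i * (a i * t))
        else Complex.exp (-(a i * t) ^ 2 / 2) := by
  have hind := iIndepFun_pi (μ := signedGaussian T j) (X := fun i x => a i * x)
    fun i => by fun_prop
  rw [hind.charFun_map_fun_sum_eq_prod (fun i => ((measurable_pi_apply i).const_mul (a i)).aemeasurable),
    Finset.prod_apply]
  refine Finset.prod_congr rfl fun i _ => ?_
  have hmap : (Measure.pi (signedGaussian T j)).map (fun x => a i * x i) =
      (signedGaussian T j i).map (fun x => a i * x) := by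
    rw [← (measurePreserving_eval (signedGaussian T j) i).map_eq,
      Measure.map_map (by fun_prop) (by fun_prop)]
    rfl
  rw [hmap, charFun_map_mul]
  by_cases h : i ∈ T
  · simp only [signedGaussian, h, if_true]
    rw [charFun_map_mul]
  · simp only [signedGaussian, h, if_false]
    rw [charFun_gaussianReal]
    push_cast
    congr 1
    simp
    ring

/-- Links the product description, whose characteristic function factors, to the Euclidean one,
where orthogonal projections are available. -/
lemma pi_signedGaussian_map_sum (T : Finset ι) {j : ι → ℝ} (hj : ∀ i, j i = 1 ∨ j i = -1)
    (a : EuclideanSpace ℝ ι) :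
    (Measure.pi (signedGaussian T j)).map (fun x => ∑ i, a i * x i) =
      (2 : ENNReal) ^ T.card • ((stdGaussian (EuclideanSpace ℝ ι)).restrict
        {x | ∀ i ∈ T, 0 ≤ j i * x i}).map (fun x => inner ℝ a x) := by
  have hD : MeasurableSet {x : EuclideanSpace ℝ ι | ∀ i ∈ T, 0 ≤ j i * x i} := by
    have : {x : EuclideanSpace ℝ ι | ∀ i ∈ T, 0 ≤ j i * x i} =
        ⋂ i ∈ T, {x : EuclideanSpace ℝ ι | 0 ≤ j i * x i} := by
      ext; simp
    rw [this]
    exact T.measurableSet_biInter fun i _ => measurableSet_le (by fun_prop) (by fun_prop)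
  rw [pi_signedGaussian T hj, Measure.map_smul, ← map_pi_eq_stdGaussian,
    Measure.restrict_map (by fun_prop) hD, Measure.map_map (by fun_prop) (by fun_prop)]
  congr 2
  ext x
  simp [PiLp.inner_apply, mul_comm]

end SignedGaussian

lemma charFun_map_const_mul_add_sum {Ω : Type*} [MeasurableSpace Ω] {P : Measure Ω}
    [IsProbabilityMeasure P] {t₁ t₂ : ℕ} {X₁ : Ω → ℝ} {X' : Fin t₁ → Ω → ℝ} {X'' : Fin t₂ → Ω → ℝ}
    {μ μ' μ'' : Measure ℝ} (hX₁ : HasLaw X₁ μ P) (hX' : ∀ i, HasLaw (X' i) μ' P)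
    (hX'' : ∀ i, HasLaw (X'' i) μ'' P)
    (hindep : iIndepFun (Sum.elim (fun _ : Unit => X₁) (Sum.elim X' X'')) P) (c c' c'' t : ℝ) :
    charFun (P.map fun ω => c * X₁ ω + c' * ∑ i, X' i ω + c'' * ∑ i, X'' i ω) t =
      charFun μ (c * t) * charFun μ' (c' * t) ^ t₁ * charFun μ'' (c'' * t) ^ t₂ := by
  set X := Sum.elim (fun _ : Unit => X₁) (Sum.elim X' X'') with hX
  set d : Unit ⊕ (Fin t₁ ⊕ Fin t₂) → ℝ :=
    Sum.elim (fun _ => c) (Sum.elim (fun _ => c') (fun _ => c''))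
  have hm : ∀ s, AEMeasurable (X s) P := by
    rintro (s | s | s)
    · exact hX₁.aemeasurable
    · exact (hX' s).aemeasurable
    · exact (hX'' s).aemeasurable
  have hind : iIndepFun (fun s ω => d s * X s ω) P :=
    hindep.comp (fun s x => d s * x) fun s => by fun_prop
  have hsum : (fun ω => c * X₁ ω + c' * ∑ i, X' i ω + c'' * ∑ i, X'' i ω) =
      fun ω => ∑ s, d s * X s ω := by
    funext ω
    simp [Fintype.sum_sum_type, d, hX, Finset.mul_sum, add_assoc]
  rw [hsum, hind.charFun_map_fun_sum_eq_prod (fun s => (hm s).const_mul _), Finset.prod_apply]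
  simp_rw [charFun_map_mul_comp (hm _)]
  simp [Fintype.prod_sum_type, d, hX, hX₁.map_eq, fun i => (hX' i).map_eq,
    fun i => (hX'' i).map_eq, mul_assoc]

/-! ### Identification of the law of `Z`. -/

section TwoClasses

variable {ι : Type*} [Fintype ι] [DecidableEq ι] {K₁ K₂ : Finset ι} {w₁ w₂ : ℝ} {w : ι → ℝ}

/-- A general commutative monoid serves both for products of characteristic functions and, through
`Multiplicative`, for sums of weights and cardinalities. -/
lemma prod_comp_of_two_classes {M : Type*} [CommMonoid M] (hdisj : Disjoint K₁ K₂)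
    (hunion : K₁ ∪ K₂ = Finset.univ) (hw₁ : ∀ i ∈ K₁, w i = w₁) (hw₂ : ∀ i ∈ K₂, w i = w₂)
    (S : Finset ι) (g : ℝ → M) :
    ∏ i ∈ S, g (w i) = g w₁ ^ (S ∩ K₁).card * g w₂ ^ (S ∩ K₂).card := by
  have hS : S = (S ∩ K₁) ∪ (S ∩ K₂) := by
    rw [← Finset.inter_union_distrib_left, hunion, Finset.inter_univ]
  have hd : Disjoint (S ∩ K₁) (S ∩ K₂) :=
    hdisj.mono Finset.inter_subset_right Finset.inter_subset_right
  conv_lhs => rw [hS]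
  rw [Finset.prod_union hd, Finset.prod_congr rfl fun i hi => by
      rw [hw₁ i (Finset.mem_inter.1 hi).2], Finset.prod_const]
  congr 1
  rw [Finset.prod_congr rfl fun i hi => by
      rw [hw₂ i (Finset.mem_inter.1 hi).2], Finset.prod_const]

lemma sum_sq_of_two_classes (hdisj : Disjoint K₁ K₂)
    (hunion : K₁ ∪ K₂ = Finset.univ) (hw₁ : ∀ i ∈ K₁, w i = w₁) (hw₂ : ∀ i ∈ K₂, w i = w₂)
    (S : Finset ι) :
    ∑ i ∈ S, w i ^ 2 = (S ∩ K₁).card * w₁ ^ 2 + (S ∩ K₂).card * w₂ ^ 2 := by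
  have := prod_comp_of_two_classes hdisj hunion hw₁ hw₂ S
    (fun x => Multiplicative.ofAdd (x ^ 2))
  rw [← ofAdd_sum, ← ofAdd_nsmul, ← ofAdd_nsmul, ← ofAdd_add] at this
  simpa using Multiplicative.ofAdd.injective this

/-- The normal vector of the hyperplane which contains the cone of a face supported on `L`. -/
noncomputable def faceNormal (w j : ι → ℝ) (L : Finset ι) : EuclideanSpace ℝ ι :=
  WithLp.toLp 2 fun i => if i ∈ L then -(w i * j i / √2) else 0

lemma norm_sq_faceNormal (w : ι → ℝ) {j : ι → ℝ} (hj : ∀ i, j i = 1 ∨ j i = -1) (L : Finset ι) :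
    ‖faceNormal w j L‖ ^ 2 = (∑ i ∈ L, w i ^ 2) / 2 := by
  have h : ∀ i, (faceNormal w j L i) ^ 2 = if i ∈ L then w i ^ 2 / 2 else 0 := by
    intro i
    have h2 : j i ^ 2 = 1 := by rcases hj i with h | h <;> simp [h]
    simp only [faceNormal]
    split_ifs
    · rw [neg_sq, div_pow, mul_pow, h2, mul_one, Real.sq_sqrt (by norm_num)]
    · simp
  rw [EuclideanSpace.real_norm_sq_eq]
  simp_rw [h]
  rw [Finset.sum_ite_mem, Finset.univ_inter, Finset.sum_div]

/-- The law of the random variable `Z` in terms of a standard Gaussian vector. -/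
lemma map_eq_stdGaussian_restrict_map (hdisj : Disjoint K₁ K₂)
    (hunion : K₁ ∪ K₂ = Finset.univ) (hwK₁ : ∀ i ∈ K₁, w i = w₁) (hwK₂ : ∀ i ∈ K₂, w i = w₂)
    (hw₁ : 0 < w₁) (hw₂ : 0 < w₂)
    {k₁ k₂ t₁ t₂ : ℕ} (hk : 1 ≤ k₁ + k₂) {K L : Finset ι} (hKL : K ⊆ L)
    (hKK₁ : (K ∩ K₁).card = k₁) (hKK₂ : (K ∩ K₂).card = k₂)
    (hLK₁ : (L ∩ K₁).card = k₁ + t₁) (hLK₂ : (L ∩ K₂).card = k₂ + t₂)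
    {j : ι → ℝ} (hj : ∀ i, j i = 1 ∨ j i = -1)
    {Ω : Type*} [MeasurableSpace Ω] {P : Measure Ω} [IsProbabilityMeasure P]
    {X₁ : Ω → ℝ} {X' : Fin t₁ → Ω → ℝ} {X'' : Fin t₂ → Ω → ℝ}
    (hX₁ : HasLaw X₁ (gaussianReal 0 (1 / (2 * (k₁ * w₁ ^ 2 + k₂ * w₂ ^ 2))).toNNReal) P)
    (hX' : ∀ i, HasLaw (X' i) (halfNormal (1 / (2 * w₁ ^ 2)).toNNReal) P)
    (hX'' : ∀ i, HasLaw (X'' i) (halfNormal (1 / (2 * w₂ ^ 2)).toNNReal) P)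
    (hindep : iIndepFun (Sum.elim (fun _ : Unit => X₁) (Sum.elim X' X'')) P)
    {Z : Ω → ℝ}
    (hZ : ∀ ω, Z ω = (k₁ * w₁ ^ 2 + k₂ * w₂ ^ 2) * X₁ ω
      - w₁ ^ 2 * ∑ i, X' i ω - w₂ ^ 2 * ∑ i, X'' i ω) :
    P.map Z = (2 : ENNReal) ^ (t₁ + t₂) • ((stdGaussian (EuclideanSpace ℝ ι)).restrict
        {x | ∀ i ∈ L \ K, 0 ≤ j i * x i}).map (fun x => inner ℝ (faceNormal w j L) x) := by
  have hT₁ : ((L \ K) ∩ K₁).card = t₁ := by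
    have : (L \ K) ∩ K₁ = (L ∩ K₁) \ (K ∩ K₁) := by ext; simp; tauto
    rw [this, Finset.card_sdiff_of_subset (Finset.inter_subset_inter_right hKL)]
    omega
  have hT₂ : ((L \ K) ∩ K₂).card = t₂ := by
    have : (L \ K) ∩ K₂ = (L ∩ K₂) \ (K ∩ K₂) := by ext; simp; tauto
    rw [this, Finset.card_sdiff_of_subset (Finset.inter_subset_inter_right hKL)]
    omega
  have hT : (L \ K).card = t₁ + t₂ := by
    have := prod_comp_of_two_classes hdisj hunion hwK₁ hwK₂ (L \ K)
      (fun _ => Multiplicative.ofAdd (1 : ℕ))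
    rw [hT₁, hT₂, ← ofAdd_sum, ← ofAdd_nsmul, ← ofAdd_nsmul, ← ofAdd_add] at this
    simpa using Multiplicative.ofAdd.injective this
  rw [← hT, ← pi_signedGaussian_map_sum (L \ K) hj]
  have : IsProbabilityMeasure ((Measure.pi (signedGaussian (L \ K) j)).map
      fun x => ∑ i, faceNormal w j L i * x i) :=
    Measure.isProbabilityMeasure_map (Finset.measurable_sum _ fun i _ =>
      (measurable_pi_apply i).const_mul _).aemeasurable
  apply Measure.ext_of_charFun
  ext t
  set s := (k₁ * w₁ ^ 2 + k₂ * w₂ ^ 2 : ℝ) with hs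
  have hs0 : 0 < s := by
    rcases Nat.eq_zero_or_pos k₁ with h | h
    · have : 0 < k₂ := by omega
      positivity
    · positivity
  have hZ' : Z = fun ω => s * X₁ ω + -w₁ ^ 2 * ∑ i, X' i ω + -w₂ ^ 2 * ∑ i, X'' i ω := by
    funext ω
    rw [hZ]
    ring
  -- An index of weight `x` contributes the factor `φ x` if it lies in `L \ K` and `ψ x` if it lies
  -- in `K`.
  set φ : ℝ → ℂ := fun x => charFun (halfNormal 1) (-(x * t / √2)) with hφ
  set ψ : ℝ → ℂ := fun x => Complex.exp (-(x * t) ^ 2 / 4) with hψ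
  -- `HN(0, 1/(2x²))` is `HN(0, 1)` scaled by `1/(√2 x)`, so multiplying by `-x²` leaves the scale
  -- `-x/√2`.
  have hhalf : ∀ x : ℝ, 0 < x →
      charFun (halfNormal (1 / (2 * x ^ 2)).toNNReal) (-x ^ 2 * t) = φ x := by
    intro x hx
    have h := halfNormal_map_const_mul (c := 1 / (√2 * x)) (by positivity) 1
    have h2 : (1 / (√2 * x)) ^ 2 = 1 / (2 * x ^ 2) := by
      rw [div_pow, mul_pow, Real.sq_sqrt (by norm_num), one_pow]
    rw [mul_one, h2] at h
    rw [← h, charFun_map_mul]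
    simp only [hφ]
    congr 1
    field_simp
  -- `s * X₁` has variance `s / 2`, like a sum of independent Gaussians of variance `w i ^ 2 / 2`
  -- over `i ∈ K`.
  have hgauss : charFun (gaussianReal 0 (1 / (2 * s)).toNNReal) (s * t) = ψ w₁ ^ k₁ * ψ w₂ ^ k₂ := by
    rw [charFun_gaussianReal, ← Complex.exp_nat_mul, ← Complex.exp_nat_mul, ← Complex.exp_add,
      Real.coe_toNNReal _ (by positivity)]
    congr 1
    have hsc : (s : ℂ) ≠ 0 := by exact_mod_cast hs0.ne'
    have h1 : ((1 / (2 * s) : ℝ) : ℂ) * (((s * t : ℝ)) : ℂ) ^ 2 / 2 = (s : ℂ) * t ^ 2 / 4 := by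
      push_cast
      field_simp
      ring
    rw [h1, hs]
    push_cast
    ring
  rw [hZ', charFun_map_const_mul_add_sum hX₁ hX' hX'' hindep, hhalf w₁ hw₁, hhalf w₂ hw₂, hgauss,
    charFun_pi_signedGaussian]
  have hfac : ∀ i, (if i ∈ L \ K then
      charFun (halfNormal 1) (j i * (faceNormal w j L i * t))
        else Complex.exp (-(faceNormal w j L i * t) ^ 2 / 2)) =
      (if i ∈ K then ψ (w i) else 1) * (if i ∈ L \ K then φ (w i) else 1) := by
    intro i
    have h2 : j i ^ 2 = 1 := by rcases hj i with h | h <;> simp [h]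
    by_cases hK : i ∈ K
    · have hL := hKL hK
      have hq : (faceNormal w j L i) ^ 2 = w i ^ 2 / 2 := by
        simp only [faceNormal, hL, if_true]
        rw [neg_sq, div_pow, mul_pow, h2, mul_one, Real.sq_sqrt (by norm_num)]
      have hq' : ((faceNormal w j L i : ℝ) : ℂ) ^ 2 = (w i : ℂ) ^ 2 / 2 := by exact_mod_cast hq
      simp only [Finset.mem_sdiff, hK, hL, not_true_eq_false, and_false, if_false, if_true, mul_one,
        hψ]
      congr 1
      rw [mul_pow, hq']
      ring
    · by_cases hL : i ∈ L
      · simp only [Finset.mem_sdiff, hK, hL, not_false_eq_true, and_true, if_true, if_false,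
          one_mul, hφ, faceNormal]
        congr 1
        -- The sign in the normal vector cancels the sign imposed on the coordinate.
        have : j i * (-(w i * j i / √2) * t) = -(j i ^ 2 * (w i * t / √2)) := by ring
        rw [this, h2, one_mul]
      · simp [hK, hL, faceNormal]
  rw [Finset.prod_congr rfl fun i _ => hfac i, Finset.prod_mul_distrib, Finset.prod_ite_mem,
    Finset.prod_ite_mem, Finset.univ_inter, Finset.univ_inter,
    prod_comp_of_two_classes hdisj hunion hwK₁ hwK₂, prod_comp_of_two_classes hdisj hunion hwK₁ hwK₂,
    hKK₁, hKK₂, hT₁, hT₂]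
  ring

end TwoClasses

/-! ### Simplices, their cones and the spans of these. -/

section Faces

variable {n : ℕ} {w j : Fin n → ℝ}

/-- The simplex with the vertices `jᵢ eᵢ / wᵢ`, `i ∈ L`. -/
def signedSimplex (w j : Fin n → ℝ) (L : Finset (Fin n)) : Set (EuclideanSpace ℝ (Fin n)) :=
  convexHull ℝ ((fun i => EuclideanSpace.single i (j i / w i)) '' (L : Set (Fin n)))

lemma sign_mul_sign (hj : ∀ i, j i = 1 ∨ j i = -1) (i : Fin n) : j i * j i = 1 := by
  rcases hj i with h | h <;> simp [h]

/-- The numbers `w i * (j i * y i)` are the barycentric coordinates of `y`. -/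
lemma mem_signedSimplex_iff (hw : ∀ i, 0 < w i) (hj : ∀ i, j i = 1 ∨ j i = -1)
    (L : Finset (Fin n)) (y : EuclideanSpace ℝ (Fin n)) :
    y ∈ signedSimplex w j L ↔ (∀ i ∉ L, y i = 0) ∧ (∀ i ∈ L, 0 ≤ j i * y i) ∧
      ∑ i ∈ L, w i * (j i * y i) = 1 := by
  constructor
  · intro hy
    let S : Set (EuclideanSpace ℝ (Fin n)) := {y | (∀ i ∉ L, y i = 0) ∧ (∀ i ∈ L, 0 ≤ j i * y i) ∧
      ∑ i ∈ L, w i * (j i * y i) = 1}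
    have hconv : Convex ℝ S := by
      rintro x ⟨hx1, hx2, hx3⟩ z ⟨hz1, hz2, hz3⟩ a b ha hb hab
      refine ⟨fun i hi => ?_, fun i hi => ?_, ?_⟩
      · simp [hx1 i hi, hz1 i hi]
      · have : j i * (a • x + b • z) i = a * (j i * x i) + b * (j i * z i) := by
          simp only [PiLp.add_apply, PiLp.smul_apply, smul_eq_mul]
          ring
        rw [this]
        have := hx2 i hi
        have := hz2 i hi
        positivity
      · have : ∀ i, w i * (j i * (a • x + b • z) i) =
            a * (w i * (j i * x i)) + b * (w i * (j i * z i)) := by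
          intro i
          simp only [PiLp.add_apply, PiLp.smul_apply, smul_eq_mul]
          ring
        simp_rw [this]
        rw [Finset.sum_add_distrib, ← Finset.mul_sum, ← Finset.mul_sum, hx3, hz3]
        linarith
    refine convexHull_min ?_ hconv hy
    rintro _ ⟨i, hi, rfl⟩
    have hi' : i ∈ L := hi
    have hval : ∀ k, j k * (EuclideanSpace.single i (j i / w i) : EuclideanSpace ℝ (Fin n)) k =
        if k = i then 1 / w i else 0 := by
      intro k
      by_cases h : k = i
      · subst h
        simp only [PiLp.single_apply, if_true]
        rw [← mul_div_assoc, sign_mul_sign hj]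
      · simp [h]
    refine ⟨fun k hk => ?_, fun k hk => ?_, ?_⟩
    · have : k ≠ i := fun h => hk (h ▸ hi')
      simp [this]
    · have := hw i
      simp only [hval]
      split_ifs <;> positivity
    · simp only [hval]
      simp [hi', (hw i).ne']
  · rintro ⟨h0, hpos, hsum⟩
    have hy : y = ∑ i ∈ L, (w i * (j i * y i)) • EuclideanSpace.single i (j i / w i) := by
      ext k
      simp only [WithLp.ofLp_sum, WithLp.ofLp_smul, Finset.sum_apply, Pi.smul_apply, smul_eq_mul,
        PiLp.single_apply, mul_ite, mul_zero]
      by_cases hk : k ∈ L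
      · rw [Finset.sum_ite_eq L k, if_pos hk]
        have := (hw k).ne'
        have h1 := sign_mul_sign hj k
        field_simp
        linear_combination (-y k) * h1
      · rw [Finset.sum_ite_eq L k, if_neg hk, h0 k hk]
    rw [hy]
    refine (convex_convexHull ℝ _).sum_mem (fun i hi => mul_nonneg (hw i).le (hpos i hi)) hsum
      fun i hi => subset_convexHull ℝ _ ⟨i, hi, rfl⟩

lemma single_mem_signedSimplex (w j : Fin n → ℝ) {L : Finset (Fin n)} {i : Fin n} (hi : i ∈ L) :
    EuclideanSpace.single i (j i / w i) ∈ signedSimplex w j L :=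
  subset_convexHull ℝ _ ⟨i, hi, rfl⟩

/-- Inclusion is decided at the vertices. It allows nested faces to be described by one common sign
vector. -/
lemma signedSimplex_subset_iff (hw : ∀ i, 0 < w i) {j' : Fin n → ℝ}
    (hj : ∀ i, j i = 1 ∨ j i = -1) (hj' : ∀ i, j' i = 1 ∨ j' i = -1) {K L : Finset (Fin n)} :
    signedSimplex w j' K ⊆ signedSimplex w j L ↔ K ⊆ L ∧ ∀ i ∈ K, j' i = j i := by
  constructor
  · intro h
    have key : ∀ i ∈ K, i ∈ L ∧ j' i = j i := by
      intro i hi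
      have hmem := (mem_signedSimplex_iff hw hj L _).1 (h (single_mem_signedSimplex w j' hi))
      have hwi := hw i
      have hne : j' i ≠ 0 := by rcases hj' i with h | h <;> simp [h]
      have hiL : i ∈ L := by
        by_contra hcon
        have := hmem.1 i hcon
        simp [hne, hwi.ne'] at this
      refine ⟨hiL, ?_⟩
      have hsgn := hmem.2.1 i hiL
      simp only [PiLp.single_apply, if_true] at hsgn
      rcases hj i with h1 | h1 <;> rcases hj' i with h2 | h2 <;> rw [h1, h2] at hsgn ⊢ <;>
        exfalso
      · have : 0 < 1 / w i := by positivity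
        rw [neg_div] at hsgn
        linarith
      · have : 0 < 1 / w i := by positivity
        linarith
    exact ⟨fun i hi => (key i hi).1, fun i hi => (key i hi).2⟩
  · rintro ⟨hKL, hjj⟩
    refine convexHull_mono ?_
    rintro _ ⟨i, hi, rfl⟩
    exact ⟨i, hKL hi, by simp only [hjj i hi]⟩

lemma exists_mem_intrinsicInterior_signedSimplex (hw : ∀ i, 0 < w i)
    (hj : ∀ i, j i = 1 ∨ j i = -1) {K : Finset (Fin n)} (hK : K.Nonempty) :
    ∃ x ∈ intrinsicInterior ℝ (signedSimplex w j K), ∀ i ∈ K, 0 < j i * x i := by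
  have hcard : (0 : ℝ) < K.card := by exact_mod_cast hK.card_pos
  set x : EuclideanSpace ℝ (Fin n) :=
    WithLp.toLp 2 fun i => if i ∈ K then j i / (K.card * w i) else 0 with hx
  have hval : ∀ i ∈ K, j i * x i = 1 / (K.card * w i) := by
    intro i hi
    simp only [hx, hi, if_true]
    rw [← mul_div_assoc, sign_mul_sign hj]
  have hpos : ∀ i ∈ K, 0 < j i * x i := by
    intro i hi
    have := hw i
    rw [hval i hi]
    positivity
  have hxF : x ∈ signedSimplex w j K := by
    refine (mem_signedSimplex_iff hw hj K x).2 ⟨fun i hi => by simp [hx, hi],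
      fun i hi => (hpos i hi).le, ?_⟩
    have : ∀ i ∈ K, w i * (j i * x i) = 1 / K.card := by
      intro i hi
      have := (hw i).ne'
      rw [hval i hi]
      field_simp
    rw [Finset.sum_congr rfl this, Finset.sum_const, nsmul_eq_mul]
    field_simp
  have hspan : ∀ y ∈ affineSpan ℝ (signedSimplex w j K), (∀ i ∉ K, y i = 0) ∧
      ∑ i ∈ K, w i * (j i * y i) = 1 := by
    intro y hy
    refine affineSpan_induction hy (fun y hy => ?_) fun c u v z hu hv hz => ?_
    · have := (mem_signedSimplex_iff hw hj K y).1 hy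
      exact ⟨this.1, this.2.2⟩
    · refine ⟨fun i hi => by simp [hu.1 i hi, hv.1 i hi, hz.1 i hi], ?_⟩
      have : ∀ i, w i * (j i * (c • (u -ᵥ v) +ᵥ z) i) = c * (w i * (j i * u i)) -
          c * (w i * (j i * v i)) + w i * (j i * z i) := by
        intro i
        simp only [vsub_eq_sub, vadd_eq_add, PiLp.add_apply, PiLp.smul_apply, PiLp.sub_apply,
          smul_eq_mul]
        ring
      simp_rw [this]
      rw [Finset.sum_add_distrib, Finset.sum_sub_distrib, ← Finset.mul_sum, ← Finset.mul_sum,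
        hu.2, hv.2, hz.2]
      ring
  refine ⟨x, mem_intrinsicInterior.2 ⟨⟨x, subset_affineSpan ℝ _ hxF⟩, ?_, rfl⟩, hpos⟩
  -- The witness is the barycentre. On the affine span the support and sum conditions are automatic,
  -- so strict positivity defines an open subset of the simplex.
  refine mem_interior.2 ⟨{y | ∀ i ∈ K, 0 < j i * (y : EuclideanSpace ℝ (Fin n)) i}, ?_, ?_, hpos⟩
  · rintro ⟨y, hy⟩ hyK
    obtain ⟨h1, h2⟩ := hspan y hy
    exact (mem_signedSimplex_iff hw hj K y).2 ⟨h1, fun i hi => (hyK i hi).le, h2⟩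
  · have : {y : affineSpan ℝ (signedSimplex w j K) |
        ∀ i ∈ K, 0 < j i * (y : EuclideanSpace ℝ (Fin n)) i} =
        ⋂ i ∈ K, {y : affineSpan ℝ (signedSimplex w j K) |
          0 < j i * (y : EuclideanSpace ℝ (Fin n)) i} := by
      ext; simp
    rw [this]
    exact isOpen_biInter_finset fun i _ => isOpen_lt continuous_const (by fun_prop)

/-- Only the sign constraints with index in `L \ K` are tight on the smaller simplex. At an interior
point the coordinates in `K` are strictly signed, so a short step in the direction `v` does not
violate them. -/
lemma mem_observedCone_signedSimplex_iff (hw : ∀ i, 0 < w i) (hj : ∀ i, j i = 1 ∨ j i = -1)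
    {K L : Finset (Fin n)} (hK : K.Nonempty) (hKL : K ⊆ L) (v : EuclideanSpace ℝ (Fin n)) :
    v ∈ observedCone (signedSimplex w j K) (signedSimplex w j L) ↔
      (∀ i ∉ L, v i = 0) ∧ ∑ i ∈ L, w i * (j i * v i) = 0 ∧ ∀ i ∈ L \ K, 0 ≤ j i * v i := by
  constructor
  · rintro ⟨x, hx, y, hy, c, hc, rfl⟩
    have hxF := intrinsicInterior_subset hx
    have hxK := (mem_signedSimplex_iff hw hj K x).1 hxF
    have hxL := (mem_signedSimplex_iff hw hj L x).1
      ((signedSimplex_subset_iff hw hj hj).2 ⟨hKL, fun _ _ => rfl⟩ hxF)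
    have hyL := (mem_signedSimplex_iff hw hj L y).1 hy
    refine ⟨fun i hi => by simp [hxL.1 i hi, hyL.1 i hi], ?_, fun i hi => ?_⟩
    · have : ∀ i, w i * (j i * (c • (y - x)) i) =
          c * (w i * (j i * y i)) - c * (w i * (j i * x i)) := by
        intro i
        simp only [PiLp.smul_apply, PiLp.sub_apply, smul_eq_mul]
        ring
      simp_rw [this]
      rw [Finset.sum_sub_distrib, ← Finset.mul_sum, ← Finset.mul_sum, hxL.2.2, hyL.2.2, sub_self]
    · obtain ⟨hiL, hiK⟩ := Finset.mem_sdiff.1 hi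
      have : j i * (c • (y - x)) i = c * (j i * y i) := by
        simp only [PiLp.smul_apply, PiLp.sub_apply, smul_eq_mul, hxK.1 i hiK]
        ring
      rw [this]
      exact mul_nonneg hc (hyL.2.1 i hiL)
  · rintro ⟨h0, hsum, hpos⟩
    obtain ⟨x, hx, hxpos⟩ := exists_mem_intrinsicInterior_signedSimplex hw hj hK
    have hxF := intrinsicInterior_subset hx
    have hxL := (mem_signedSimplex_iff hw hj L x).1
      ((signedSimplex_subset_iff hw hj hj).2 ⟨hKL, fun _ _ => rfl⟩ hxF)
    have hev : ∀ᶠ ε : ℝ in nhds 0, ∀ i ∈ K, 0 < j i * x i + ε * (j i * v i) := by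
      refine (Finset.eventually_all K).2 fun i hi => ?_
      have hc : Continuous fun ε : ℝ => j i * x i + ε * (j i * v i) := by fun_prop
      exact hc.continuousAt.eventually (lt_mem_nhds (by simpa using hxpos i hi))
    obtain ⟨ε, hε, hε0⟩ := ((hev.filter_mono nhdsWithin_le_nhds).and
      (self_mem_nhdsWithin (s := Set.Ioi (0 : ℝ)))).exists
    have hε0 : 0 < ε := hε0
    refine ⟨x, hx, x + ε • v, ?_, ε⁻¹, (inv_pos.2 hε0).le, ?_⟩
    · refine (mem_signedSimplex_iff hw hj L _).2
        ⟨fun i hi => by simp [hxL.1 i hi, h0 i hi], fun i hi => ?_, ?_⟩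
      · have : j i * (x + ε • v) i = j i * x i + ε * (j i * v i) := by
          simp only [PiLp.add_apply, PiLp.smul_apply, smul_eq_mul]
          ring
        rw [this]
        by_cases hiK : i ∈ K
        · exact (hε i hiK).le
        · have := hxL.2.1 i hi
          have := hpos i (Finset.mem_sdiff.2 ⟨hi, hiK⟩)
          positivity
      · have : ∀ i, w i * (j i * (x + ε • v) i) = w i * (j i * x i) + ε * (w i * (j i * v i)) := by
          intro i
          simp only [PiLp.add_apply, PiLp.smul_apply, smul_eq_mul]
          ring
        simp_rw [this]
        rw [Finset.sum_add_distrib, ← Finset.mul_sum, hxL.2.2, hsum]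
        ring
    · rw [add_sub_cancel_left, smul_smul, inv_mul_cancel₀ hε0.ne', one_smul]

/-- The cone contains a vector `u` at which all its inequalities are strict; adding a large multiple
of `u` moves any `v` into the cone, so `v` is a difference of two cone elements. -/
lemma mem_span_observedCone_signedSimplex_iff (hw : ∀ i, 0 < w i)
    (hj : ∀ i, j i = 1 ∨ j i = -1)
    {K L : Finset (Fin n)} (hK : K.Nonempty) (hKL : K ⊆ L) (v : EuclideanSpace ℝ (Fin n)) :
    v ∈ Submodule.span ℝ (observedCone (signedSimplex w j K) (signedSimplex w j L)) ↔
      (∀ i ∉ L, v i = 0) ∧ ∑ i ∈ L, w i * (j i * v i) = 0 := by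
  have hcone := mem_observedCone_signedSimplex_iff hw hj hK hKL
  have hlin : ∀ (x y : EuclideanSpace ℝ (Fin n)) (c : ℝ), ∑ i ∈ L, w i * (j i * (x + c • y) i) =
      ∑ i ∈ L, w i * (j i * x i) + c * ∑ i ∈ L, w i * (j i * y i) := by
    intro x y c
    rw [Finset.mul_sum, ← Finset.sum_add_distrib]
    refine Finset.sum_congr rfl fun i _ => ?_
    simp only [PiLp.add_apply, PiLp.smul_apply, smul_eq_mul]
    ring
  constructor
  · intro hv
    induction hv using Submodule.span_induction with
    | mem v hv => exact ⟨((hcone v).1 hv).1, ((hcone v).1 hv).2.1⟩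
    | zero => simp
    | add x y _ _ hx hy =>
      refine ⟨fun i hi => by simp [hx.1 i hi, hy.1 i hi], ?_⟩
      have := hlin x y 1
      rw [one_smul] at this
      rw [this, hx.2, hy.2]
      simp
    | smul c x _ hx =>
      refine ⟨fun i hi => by simp [hx.1 i hi], ?_⟩
      have := hlin 0 x c
      rw [zero_add] at this
      rw [this, hx.2]
      simp
  · rintro ⟨h0, hsum⟩
    obtain ⟨k, hk⟩ := hK
    have hkL := hKL hk
    -- All signed coordinates on `L` are `1`, except at `k ∈ K`, where no sign is prescribed and the
    -- value balances the weighted sum.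
    set u : EuclideanSpace ℝ (Fin n) := WithLp.toLp 2 fun i =>
      if i ∈ L.erase k then j i else if i = k then -(j k * ∑ i ∈ L.erase k, w i) / w k else 0
      with hu
    have hu1 : ∀ i ∈ L.erase k, j i * u i = 1 := by
      intro i hi
      simp only [hu, hi, if_true, sign_mul_sign hj]
    have huk : w k * (j k * u k) = -∑ i ∈ L.erase k, w i := by
      have h1 := sign_mul_sign hj k
      have h2 := (hw k).ne'
      simp only [hu, Finset.notMem_erase, if_false, if_true]
      field_simp
      linear_combination (-∑ i ∈ L.erase k, w i) * h1
    have hu0 : ∀ i ∉ L, u i = 0 := by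
      intro i hi
      have : i ≠ k := fun h => hi (h ▸ hkL)
      simp [hu, hi, this]
    have husum : ∑ i ∈ L, w i * (j i * u i) = 0 := by
      rw [← Finset.add_sum_erase L _ hkL, huk,
        Finset.sum_congr rfl fun i hi => congrArg (w i * ·) (hu1 i hi)]
      simp
    have hne : ∀ i ∈ L \ K, i ∈ L.erase k := fun i hi =>
      Finset.mem_erase.2 ⟨fun h => (Finset.mem_sdiff.1 hi).2 (h ▸ hk), (Finset.mem_sdiff.1 hi).1⟩
    have huC : u ∈ observedCone (signedSimplex w j K) (signedSimplex w j L) :=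
      (hcone u).2 ⟨hu0, husum, fun i hi => by rw [hu1 i (hne i hi)]; exact zero_le_one⟩
    set R : ℝ := ‖v‖
    have hvu : v + R • u ∈ observedCone (signedSimplex w j K) (signedSimplex w j L) := by
      refine (hcone _).2 ⟨fun i hi => by simp [h0 i hi, hu0 i hi], by rw [hlin, hsum, husum]; simp,
        fun i hi => ?_⟩
      have h1 : j i * (v + R • u) i = j i * v i + R * (j i * u i) := by
        simp only [PiLp.add_apply, PiLp.smul_apply, smul_eq_mul]
        ring
      rw [h1, hu1 i (hne i hi), mul_one]
      have h2 : |v i| ≤ R := PiLp.norm_apply_le v i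
      have h3 : |j i * v i| = |v i| := by
        rw [abs_mul]
        rcases hj i with h | h <;> simp [h]
      have := neg_abs_le (j i * v i)
      linarith
    have : v = (v + R • u) - R • u := by simp
    rw [this]
    exact Submodule.sub_mem _ (Submodule.subset_span hvu)
      (Submodule.smul_mem _ _ (Submodule.subset_span huC))

end Faces

/-! ### The angle as a value of a continuous density factor. -/

section InternalAngle

variable {n : ℕ} {w j : Fin n → ℝ}

lemma inner_faceNormal (w j : Fin n → ℝ) (L : Finset (Fin n)) (v : EuclideanSpace ℝ (Fin n)) :
    inner ℝ (faceNormal w j L) v = -(∑ i ∈ L, w i * (j i * v i)) / √2 := by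
  have h : ∀ i, inner ℝ (faceNormal w j L i) (v i) =
      if i ∈ L then -(w i * (j i * v i)) / √2 else 0 := by
    intro i
    simp only [faceNormal, RCLike.inner_apply, conj_trivial]
    split_ifs
    · ring
    · simp
  rw [PiLp.inner_apply]
  simp_rw [h]
  rw [Finset.sum_ite_mem, Finset.univ_inter, ← Finset.sum_div, Finset.sum_neg_distrib]

lemma mem_span_observedCone_iff_inner (hw : ∀ i, 0 < w i)
    (hj : ∀ i, j i = 1 ∨ j i = -1) {K L : Finset (Fin n)} (hK : K.Nonempty) (hKL : K ⊆ L)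
    (v : EuclideanSpace ℝ (Fin n)) :
    v ∈ Submodule.span ℝ (observedCone (signedSimplex w j K) (signedSimplex w j L)) ↔
      (∀ i ∉ L, v i = 0) ∧ inner ℝ (faceNormal w j L) v = 0 := by
  rw [mem_span_observedCone_signedSimplex_iff hw hj hK hKL, inner_faceNormal]
  simp

/-- The internal angle as the value at `0` of the continuous function in the density of
`⟪faceNormal w j L, x⟫`, where `x` is a Gaussian vector restricted to half-spaces. -/
lemma exists_continuous_density_internalAngle (hw : ∀ i, 0 < w i)
    (hj : ∀ i, j i = 1 ∨ j i = -1) {K L : Finset (Fin n)} (hK : K.Nonempty) (hKL : K ⊆ L) :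
    ∃ q : ℝ → ℝ, Continuous q ∧ (∀ z, 0 ≤ q z) ∧
      q 0 = internalAngle (signedSimplex w j K) (signedSimplex w j L) ∧
      ((stdGaussian (EuclideanSpace ℝ (Fin n))).restrict {x | ∀ i ∈ L \ K, 0 ≤ j i * x i}).map
        (fun x => inner ℝ (faceNormal w j L) x) =
      volume.withDensity fun z => ENNReal.ofReal
        (gaussianPDFReal 0 (‖faceNormal w j L‖ ^ 2).toNNReal z * q z) := by
  set F := signedSimplex w j K with hF
  set G := signedSimplex w j L with hG
  set V := Submodule.span ℝ (observedCone F G) with hV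
  set a := faceNormal w j L with ha
  have hmemV : ∀ v, v ∈ V ↔ (∀ i ∉ L, v i = 0) ∧ inner ℝ a v = 0 :=
    mem_span_observedCone_iff_inner hw hj hK hKL
  have hacoord : ∀ i ∈ L, a i ≠ 0 := by
    intro i hi
    have h1 := (hw i).ne'
    have h2 : j i ≠ 0 := by rcases hj i with h | h <;> simp [h]
    simp [ha, faceNormal, hi, h1, h2]
  have ha0 : a ≠ 0 := by
    obtain ⟨k, hk⟩ := hK
    intro h
    exact hacoord k (hKL hk) (by rw [h]; rfl)
  have haV : a ∈ Vᗮ := by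
    refine (Submodule.mem_orthogonal V a).2 fun v hv => ?_
    rw [real_inner_comm]
    exact ((hmemV v).1 hv).2
  have hnorm : ‖a‖ ^ 2 ≠ 0 := by simpa using ha0
  -- `c i • a` is the orthogonal projection to `ℝ a` of the constraint normal `j i • eᵢ`; for `i ∈
  -- L` the remainder `b i` lies in `V`.
  set c : Fin n → ℝ := fun i => j i * a i / ‖a‖ ^ 2
  have hex : ∀ i, ∃ b : V, i ∈ L →
      (b : EuclideanSpace ℝ (Fin n)) + c i • a = EuclideanSpace.single i (j i) := by
    intro i
    by_cases hi : i ∈ L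
    · refine ⟨⟨EuclideanSpace.single i (j i) - c i • a, (hmemV _).2 ⟨fun k hk => ?_, ?_⟩⟩,
        fun _ => sub_add_cancel _ _⟩
      · have hki : k ≠ i := fun h => hk (h ▸ hi)
        simp [hki, ha, faceNormal, hk]
      · rw [inner_sub_right, inner_smul_right, real_inner_self_eq_norm_sq,
          div_mul_cancel₀ _ hnorm, EuclideanSpace.inner_single_right]
        simp
    · exact ⟨0, fun h => absurd h hi⟩
  choose b hb using hex
  have hbinner : ∀ i ∈ L, ∀ x : EuclideanSpace ℝ (Fin n),
      inner ℝ ((b i : EuclideanSpace ℝ (Fin n)) + c i • a) x = j i * x i := by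
    intro i hi x
    rw [hb i hi, EuclideanSpace.inner_single_left]
    simp
  have hbV : ∀ i ∈ L, ∀ v : V, inner ℝ (b i) v = j i * (v : EuclideanSpace ℝ (Fin n)) i := by
    intro i hi v
    rw [← hbinner i hi, inner_add_left, inner_smul_left, ((hmemV v).1 v.2).2]
    simp
  -- Otherwise `eᵢ` would be parallel to `a`, which also has a nonzero coordinate at some `k ∈ K`,
  -- `k ≠ i`.
  have hb0 : ∀ i ∈ L \ K, b i ≠ 0 := by
    intro i hi hbi
    obtain ⟨hiL, hiK⟩ := Finset.mem_sdiff.1 hi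
    obtain ⟨k, hk⟩ := hK
    have hki : k ≠ i := fun h => hiK (h ▸ hk)
    have hci : c i ≠ 0 := by
      have h2 : j i ≠ 0 := by rcases hj i with h | h <;> simp [h]
      exact div_ne_zero (mul_ne_zero h2 (hacoord i hiL)) hnorm
    have h := congrArg (fun v : EuclideanSpace ℝ (Fin n) => v k) (hb i hiL)
    simp [hbi, hki, hci, hacoord k (hKL hk)] at h
  have hcone : {v : V | (v : EuclideanSpace ℝ (Fin n)) ∈ observedCone F G} =
      {v : V | ∀ i ∈ L \ K, 0 ≤ inner ℝ (b i) v} := by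
    ext v
    have h1 := mem_observedCone_signedSimplex_iff hw hj hK hKL (v : EuclideanSpace ℝ (Fin n))
    have h2 := (mem_span_observedCone_signedSimplex_iff hw hj hK hKL
      (v : EuclideanSpace ℝ (Fin n))).1 v.2
    simp only [Set.mem_ofPred_eq]
    rw [h1, and_iff_right h2.1, and_iff_right h2.2]
    exact forall₂_congr fun i hi => by rw [hbV i (Finset.mem_sdiff.1 hi).1]
  refine ⟨fun z => (stdGaussian V).real {x | ∀ i ∈ L \ K, 0 ≤ inner ℝ (b i) x + c i * z},
    continuous_stdGaussian_real_halfSpaces (L \ K) b c hb0, fun z => measureReal_nonneg, ?_, ?_⟩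
  · simp only [mul_zero, add_zero]
    -- If the faces agree there are no constraints, and the probability is `1`, as in the
    -- convention. Otherwise a nonzero `b i` makes `V` nontrivial, as polar coordinates require.
    by_cases hFG : F = G
    · have hLK : L \ K = ∅ :=
        Finset.sdiff_eq_empty_iff_subset.2 ((signedSimplex_subset_iff hw hj hj).1 hFG.ge).1
      rw [internalAngle, if_pos hFG, hLK]
      simp
    · have hsub : F ⊆ G := (signedSimplex_subset_iff hw hj hj).2 ⟨hKL, fun _ _ => rfl⟩
      rw [internalAngle, if_neg hFG, if_pos hsub]
      obtain ⟨i, hi⟩ : (L \ K).Nonempty := by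
        rw [Finset.nonempty_iff_ne_empty]
        intro h
        exact hFG (by rw [hF, hG, hKL.antisymm (Finset.sdiff_eq_empty_iff_subset.1 h)])
      have : Nontrivial V := ⟨b i, 0, hb0 i hi⟩
      rw [hcone]
      refine (sphereFraction_eq_stdGaussian (C := {v : V | ∀ i ∈ L \ K, 0 ≤ inner ℝ (b i) v}) ?_
        fun r hr v hv i hi => ?_).symm
      · have : {v : V | ∀ i ∈ L \ K, 0 ≤ inner ℝ (b i) v} =
            ⋂ i ∈ L \ K, {v : V | 0 ≤ inner ℝ (b i) v} := by
          ext; simp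
        rw [this]
        exact (L \ K).measurableSet_biInter fun i _ => measurableSet_le (by fun_prop) (by fun_prop)
      · rw [inner_smul_right]
        exact mul_nonneg hr.le (hv i hi)
  · rw [← stdGaussian_restrict_map_inner (L \ K) V haV ha0 b c]
    congr 2
    ext x
    exact forall₂_congr fun i hi => by rw [hbinner i (Finset.mem_sdiff.1 hi).1]

end InternalAngle

/-! ### Conclusion. -/

lemma continuous_gaussianPDFReal (μ : ℝ) (v : NNReal) : Continuous (gaussianPDFReal μ v) := by
  unfold gaussianPDFReal
  fun_prop

theorem theorem6 {n : ℕ} (K₁ K₂ : Finset (Fin n)) (hdisj : Disjoint K₁ K₂)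
    (hunion : K₁ ∪ K₂ = Finset.univ)
    (w₁ w₂ : ℝ) (hw₁ : 0 < w₁) (hw₂ : 0 < w₂)
    (w : Fin n → ℝ) (hwK₁ : ∀ i ∈ K₁, w i = w₁) (hwK₂ : ∀ i ∈ K₂, w i = w₂)
    (k₁ k₂ t₁ t₂ : ℕ) (hk : 1 ≤ k₁ + k₂)
    (F G : Set (EuclideanSpace ℝ (Fin n))) (K L : Finset (Fin n))
    (hF : IsFaceSupportedOn w F K) (hG : IsFaceSupportedOn w G L) (hFG : F ⊆ G)
    (hKK₁ : (K ∩ K₁).card = k₁) (hKK₂ : (K ∩ K₂).card = k₂)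
    (hLK₁ : (L ∩ K₁).card = k₁ + t₁) (hLK₂ : (L ∩ K₂).card = k₂ + t₂)
    {Ω : Type*} [MeasurableSpace Ω] (P : Measure Ω) [IsProbabilityMeasure P]
    (X₁ : Ω → ℝ) (X' : Fin t₁ → Ω → ℝ) (X'' : Fin t₂ → Ω → ℝ)
    (hX₁ : HasLaw X₁ (gaussianReal 0 (1 / (2 * (k₁ * w₁ ^ 2 + k₂ * w₂ ^ 2))).toNNReal) P)
    (hX' : ∀ i, HasLaw (X' i) (halfNormal (1 / (2 * w₁ ^ 2)).toNNReal) P)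
    (hX'' : ∀ i, HasLaw (X'' i) (halfNormal (1 / (2 * w₂ ^ 2)).toNNReal) P)
    (hindep : iIndepFun (Sum.elim (fun _ : Unit => X₁) (Sum.elim X' X'')) P)
    (Z : Ω → ℝ)
    (hZ : ∀ ω, Z ω = (k₁ * w₁ ^ 2 + k₂ * w₂ ^ 2) * X₁ ω
      - w₁ ^ 2 * ∑ i, X' i ω - w₂ ^ 2 * ∑ i, X'' i ω) :
    (∃ p : ℝ → ℝ, Continuous p ∧ IsDensityOf p Z P) ∧
      ∀ p : ℝ → ℝ, IsDensityOf p Z P → ContinuousAt p 0 →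
        internalAngle F G =
          Real.sqrt Real.pi / 2 ^ (t₁ + t₂)
            * Real.sqrt ((k₁ + t₁) * w₁ ^ 2 + (k₂ + t₂) * w₂ ^ 2) * p 0 := by
  obtain ⟨-, -, j', hj', rfl⟩ := hF
  obtain ⟨-, -, j, hj, rfl⟩ := hG
  have hw : ∀ i, 0 < w i := by
    intro i
    rcases Finset.mem_union.1 (hunion ▸ Finset.mem_univ i) with h | h
    · rwa [hwK₁ i h]
    · rwa [hwK₂ i h]
  -- The two faces come with separate sign vectors; these agree on `K`, so `j` can be used for both.
  obtain ⟨hKL, hjj⟩ := (signedSimplex_subset_iff hw hj hj').1 hFG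
  have hFj : convexHull ℝ ((fun i => EuclideanSpace.single i (j' i / w i)) '' (K : Set (Fin n))) =
      signedSimplex w j K := by
    rw [signedSimplex]
    congr 1
    exact Set.image_congr fun i hi => by rw [hjj i hi]
  rw [hFj]
  change _ ∧ ∀ p : ℝ → ℝ, _ → _ →
    internalAngle (signedSimplex w j K) (signedSimplex w j L) = _
  have hK : K.Nonempty := by
    rw [Finset.nonempty_iff_ne_empty]
    rintro rfl
    simp at hKK₁ hKK₂
    omega
  obtain ⟨q, hqc, hq0, hqangle, hqlaw⟩ := exists_continuous_density_internalAngle hw hj hK hKL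
  set W : ℝ := (k₁ + t₁) * w₁ ^ 2 + (k₂ + t₂) * w₂ ^ 2
  have hnorm : ‖faceNormal w j L‖ ^ 2 = W / 2 := by
    rw [norm_sq_faceNormal w hj, sum_sq_of_two_classes hdisj hunion hwK₁ hwK₂, hLK₁, hLK₂]
    push_cast
    rfl
  have hW : 0 < W := by
    rcases Nat.eq_zero_or_pos k₁ with h | h
    · have : 0 < k₂ := by omega
      positivity
    · positivity
  -- The power of 2 normalizes the restriction to the prescribed signs; `W / 2` is the variance
  -- `‖faceNormal w j L‖ ^ 2`.
  set p₀ : ℝ → ℝ := fun z => 2 ^ (t₁ + t₂) * (gaussianPDFReal 0 (W / 2).toNNReal z * q z)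
  have hp₀c : Continuous p₀ := ((continuous_gaussianPDFReal _ _).mul hqc).const_mul _
  have hdens : IsDensityOf p₀ Z P := by
    refine ⟨hp₀c.measurable, fun z => ?_, ?_⟩
    · exact mul_nonneg (by positivity) (mul_nonneg (gaussianPDFReal_nonneg _ _ _) (hq0 z))
    · rw [map_eq_stdGaussian_restrict_map hdisj hunion hwK₁ hwK₂ hw₁ hw₂ hk hKL hKK₁ hKK₂ hLK₁ hLK₂
        hj hX₁ hX' hX'' hindep hZ, hqlaw, hnorm, ← withDensity_smul]
      · congr 1
        funext z
        rw [Pi.smul_apply, smul_eq_mul,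
          ENNReal.ofReal_mul (p := 2 ^ (t₁ + t₂)) (by positivity),
          ENNReal.ofReal_pow (by norm_num), ENNReal.ofReal_ofNat]
      · exact (((continuous_gaussianPDFReal _ _).mul hqc).measurable).ennreal_ofReal
  refine ⟨⟨p₀, hp₀c, hdens⟩, fun p hp hpc => ?_⟩
  rw [eq_of_isDensityOf_of_continuousAt hp hdens hpc hp₀c.continuousAt, ← hqangle]
  have hpdf : gaussianPDFReal 0 (W / 2).toNNReal 0 = (√Real.pi * √W)⁻¹ := by
    rw [gaussianPDFReal, Real.coe_toNNReal _ (by positivity), ← Real.sqrt_mul Real.pi_pos.le]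
    have : 2 * Real.pi * (W / 2) = Real.pi * W := by ring
    rw [this]
    simp
  have h1 : 0 < √Real.pi := Real.sqrt_pos.2 Real.pi_pos
  have h2 : 0 < √W := Real.sqrt_pos.2 hW
  simp only [p₀, hpdf]
  field_simp
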